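/- Let $A$ be a real $N\times N$ matrix that is diagonalizable over $\mathbb{C}$ and all of whose complex eigenvalues have positive real part. Let $G(A)=\mathbb{R}^N\rtimes_A\mathbb{R}$ be the abelian Heintze group, that is, the manifold $\mathbb{R}^N\times\mathbb{R}$ with the product $$(x,t)*(x',t')=(x+e^{tA}x',\,t+t').$$ Equip $G(A)$ with a left-invariant Riemannian metric $g$ for which, at the identity, $\partial_t$ is a unit vector orthogonal to $\mathbb{R}^N$; equivalently, for some inner product $\langle\cdot,\cdot\rangle$ on $\mathbb{R}^N$, $$g_{(x,t)}\big((\xi,\tau),(\xi',\tau')\big)=\langle e^{-tA}\xi,e^{-tA}\xi'\rangle+\tau\tau'.$$ Then, for every $p\in G(A)$, the geodesic balls $B(p,r)$ of $g$ have finite Riemannian volume, and the volume entropy of $(G(A),g)$ exists, does not depend on $p$, and is $$\delta(G(A))=\lim_{r\to\infty}\frac{\log \operatorname{Vol}(B(p,r))}{r}=\operatorname{tr}(J),$$ where $J$ is the complex Jordan form of $A$ (in particular $\operatorname{tr}(J)$ is real). -/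

import Mathlib

open Set Filter Topology MeasureTheory Bundle
open scoped Manifold ENNReal ContDiff Matrix

/-- The group `G(A) = ℝᴺ ⋊_A ℝ`, with underlying manifold `ℝᴺ × ℝ` and the product
`(x, t) * (x', t') = (x + exp (t A) x', t + t')`. -/
def AbelianSplitGroup {N : ℕ} (_A : Matrix (Fin N) (Fin N) ℝ) : Type := (Fin N → ℝ) × ℝ

namespace AbelianSplitGroup

variable {N : ℕ} (A : Matrix (Fin N) (Fin N) ℝ)

/-! `G(A)` is the manifold `ℝᴺ × ℝ`: one global chart, the identity. -/

instance : TopologicalSpace (AbelianSplitGroup A) :=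
  inferInstanceAs (TopologicalSpace ((Fin N → ℝ) × ℝ))

instance : ChartedSpace ((Fin N → ℝ) × ℝ) (AbelianSplitGroup A) :=
  inferInstanceAs (ChartedSpace ((Fin N → ℝ) × ℝ) ((Fin N → ℝ) × ℝ))

instance : IsManifold 𝓘(ℝ, (Fin N → ℝ) × ℝ) ∞ (AbelianSplitGroup A) :=
  inferInstanceAs (IsManifold 𝓘(ℝ, (Fin N → ℝ) × ℝ) ∞ ((Fin N → ℝ) × ℝ))

instance : MeasurableSpace (AbelianSplitGroup A) :=
  inferInstanceAs (MeasurableSpace ((Fin N → ℝ) × ℝ))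

instance : BorelSpace (AbelianSplitGroup A) :=
  inferInstanceAs (BorelSpace ((Fin N → ℝ) × ℝ))

noncomputable instance : Mul (AbelianSplitGroup A) :=
  ⟨fun p q => (p.1 + NormedSpace.exp (p.2 • A) *ᵥ q.1, p.2 + q.2)⟩

instance : One (AbelianSplitGroup A) := ⟨((0 : Fin N → ℝ), (0 : ℝ))⟩

noncomputable instance : Inv (AbelianSplitGroup A) :=
  ⟨fun p => (-(NormedSpace.exp ((-p.2) • A) *ᵥ p.1), -p.2)⟩

theorem mul_fst (p q : AbelianSplitGroup A) :
    (p * q).1 = p.1 + NormedSpace.exp (p.2 • A) *ᵥ q.1 := rfl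

theorem mul_snd (p q : AbelianSplitGroup A) : (p * q).2 = p.2 + q.2 := rfl

theorem one_fst : (1 : AbelianSplitGroup A).1 = 0 := rfl

theorem one_snd : (1 : AbelianSplitGroup A).2 = 0 := rfl

theorem inv_fst (p : AbelianSplitGroup A) :
    p⁻¹.1 = -(NormedSpace.exp ((-p.2) • A) *ᵥ p.1) := rfl

theorem inv_snd (p : AbelianSplitGroup A) : p⁻¹.2 = -p.2 := rfl

theorem exp_add_smul (s t : ℝ) :
    NormedSpace.exp ((s + t) • A) = NormedSpace.exp (s • A) * NormedSpace.exp (t • A) := by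
  rw [add_smul]
  exact Matrix.exp_add_of_commute _ _ (((Commute.refl A).smul_left s).smul_right t)

noncomputable instance : Group (AbelianSplitGroup A) :=
  Group.ofLeftAxioms
    (by
      intro p q r
      refine Prod.ext ?_ ?_
      · rw [mul_fst, mul_fst, mul_fst, mul_fst, mul_snd, exp_add_smul, Matrix.mulVec_add,
          Matrix.mulVec_mulVec, add_assoc]
      · rw [mul_snd, mul_snd, mul_snd, mul_snd, add_assoc])
    (by
      intro p
      refine Prod.ext ?_ ?_
      · rw [mul_fst, one_fst, one_snd, zero_smul, NormedSpace.exp_zero, Matrix.one_mulVec, zero_add]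
      · rw [mul_snd, one_snd, zero_add])
    (by
      intro p
      refine Prod.ext ?_ ?_
      · rw [mul_fst, inv_fst, inv_snd, one_fst, neg_add_cancel]
      · rw [mul_snd, inv_snd, one_snd, neg_add_cancel])

/-- The bilinear form on `ℝᴺ × ℝ`, the tangent space of `G(A)` at a point `(x, t)`, given by
`((ξ, τ), (ξ', τ')) ↦ ⟨exp (-t A) ξ, exp (-t A) ξ'⟩_H + τ τ'` where `⟨ξ, ξ'⟩_H = ξᵀ H ξ'`. -/
noncomputable def metricForm (H : Matrix (Fin N) (Fin N) ℝ) (t : ℝ) :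
    ((Fin N → ℝ) × ℝ) →ₗ[ℝ] ((Fin N → ℝ) × ℝ) →ₗ[ℝ] ℝ :=
  LinearMap.mk₂ ℝ
    (fun v w => (NormedSpace.exp ((-t) • A) *ᵥ v.1) ⬝ᵥ
      (H *ᵥ (NormedSpace.exp ((-t) • A) *ᵥ w.1)) + v.2 * w.2)
    (by intros; simp [Matrix.mulVec_add]; ring)
    (by intros; simp [Matrix.mulVec_smul]; ring)
    (by intros; simp [Matrix.mulVec_add]; ring)
    (by intros; simp [Matrix.mulVec_smul]; ring)

theorem metricForm_apply (H : Matrix (Fin N) (Fin N) ℝ) (t : ℝ) (v w : (Fin N → ℝ) × ℝ) :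
    metricForm A H t v w = (NormedSpace.exp ((-t) • A) *ᵥ v.1) ⬝ᵥ
      (H *ᵥ (NormedSpace.exp ((-t) • A) *ᵥ w.1)) + v.2 * w.2 := rfl

theorem metricForm_symm {H : Matrix (Fin N) (Fin N) ℝ} (hH : H.PosDef) (t : ℝ)
    (v w : (Fin N → ℝ) × ℝ) : metricForm A H t v w = metricForm A H t w v := by
  have hT : Hᵀ = H := by
    have := hH.isHermitian.eq
    rwa [Matrix.conjTranspose_eq_transpose_of_trivial] at this
  have key : ∀ a b : Fin N → ℝ, a ⬝ᵥ (H *ᵥ b) = b ⬝ᵥ (H *ᵥ a) := by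
    intro a b
    rw [Matrix.dotProduct_mulVec, ← Matrix.mulVec_transpose, hT, dotProduct_comm]
  rw [metricForm_apply, metricForm_apply, key, mul_comm]

theorem exp_mulVec_ne_zero (t : ℝ) {ξ : Fin N → ℝ} (h : ξ ≠ 0) :
    NormedSpace.exp (t • A) *ᵥ ξ ≠ 0 := by
  intro h0
  apply h
  have := congrArg (fun z => NormedSpace.exp ((-t) • A) *ᵥ z) h0
  rw [Matrix.mulVec_mulVec, ← exp_add_smul, neg_add_cancel, zero_smul, NormedSpace.exp_zero,
    Matrix.one_mulVec, Matrix.mulVec_zero] at this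
  exact this

theorem metricForm_pos {H : Matrix (Fin N) (Fin N) ℝ} (hH : H.PosDef) (t : ℝ)
    (v : (Fin N → ℝ) × ℝ) (hv : v ≠ 0) : 0 < metricForm A H t v v := by
  rw [metricForm_apply]
  by_cases h1 : v.1 = 0
  · have h2 : v.2 ≠ 0 := fun h2 => hv (Prod.ext h1 h2)
    have := mul_self_pos.2 h2
    simpa [h1] using this
  · have := hH.dotProduct_mulVec_pos (exp_mulVec_ne_zero A (-t) h1)
    simp only [star_trivial] at this
    have h2 := mul_self_nonneg v.2
    linarith

end AbelianSplitGroup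

theorem isVonNBounded_of_pos {E : Type*} [NormedAddCommGroup E] [NormedSpace ℝ E]
    [FiniteDimensional ℝ E] (B : E →L[ℝ] E →L[ℝ] ℝ) (hB : ∀ v, v ≠ 0 → 0 < B v v) :
    Bornology.IsVonNBounded ℝ {v : E | B v v < 1} := by
  have : ProperSpace E := FiniteDimensional.proper ℝ E
  rw [NormedSpace.isVonNBounded_iff]
  have hcont : Continuous fun v : E => B v v := by fun_prop
  rcases (Metric.sphere (0 : E) 1).eq_empty_or_nonempty with he | hne
  · refine (Metric.isBounded_closedBall (x := (0 : E)) (r := 0)).subset fun v _ => ?_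
    by_contra hv
    have hv0 : v ≠ 0 := fun h => hv (by simp [h])
    have : ‖v‖⁻¹ • v ∈ Metric.sphere (0 : E) 1 := by
      simp [norm_smul, hv0]
    simp [he] at this
  · obtain ⟨u, hu, hmin⟩ := (isCompact_sphere (0 : E) 1).exists_isMinOn hne hcont.continuousOn
    have hu0 : u ≠ 0 := by
      rintro rfl
      simp at hu
    have hc := hB u hu0
    set c := B u u with hcdef
    refine (Metric.isBounded_closedBall (x := (0 : E)) (r := √(1 / c))).subset fun v hv => ?_
    rw [mem_closedBall_zero_iff]
    apply Real.le_sqrt_of_sq_le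
    by_cases hv0 : v = 0
    · simp [hv0, hc.le]
    have hs : ‖v‖⁻¹ • v ∈ Metric.sphere (0 : E) 1 := by
      simp [norm_smul, hv0]
    have h1 : c ≤ B (‖v‖⁻¹ • v) (‖v‖⁻¹ • v) := hmin hs
    have hn : 0 < ‖v‖ := norm_pos_iff.2 hv0
    have h2 : B (‖v‖⁻¹ • v) (‖v‖⁻¹ • v) = B v v / ‖v‖ ^ 2 := by
      simp
      field_simp
    rw [h2, le_div_iff₀ (by positivity)] at h1
    rw [le_div_iff₀ hc]
    have h3 : B v v < 1 := hv
    linarith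

/-- The left-invariant Riemannian metric on `G(A)` which at the identity is the inner product
of the Lie algebra `ℝᴺ × ℝ` that restricts to the inner product with Gram matrix `H` on `ℝᴺ` and
for which the generator `∂_t` (which acts on `ℝᴺ` by `A`) is a unit vector orthogonal to `ℝᴺ`. -/
noncomputable def leftInvariantMetric {N : ℕ} (A H : Matrix (Fin N) (Fin N) ℝ) (hH : H.PosDef) :
    RiemannianMetric (fun p : AbelianSplitGroup A => TangentSpace 𝓘(ℝ, (Fin N → ℝ) × ℝ) p) where
  inner p := (AbelianSplitGroup.metricForm A H p.2).toContinuousBilinearMap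
  symm p v w := AbelianSplitGroup.metricForm_symm A hH p.2 v w
  pos p v hv := AbelianSplitGroup.metricForm_pos A hH p.2 v hv
  continuousAt p := by
    let B : ((Fin N → ℝ) × ℝ) →L[ℝ] ((Fin N → ℝ) × ℝ) →L[ℝ] ℝ :=
      (AbelianSplitGroup.metricForm A H p.2).toContinuousBilinearMap
    have : Continuous fun v => B v v := by fun_prop
    exact this.continuousAt
  isVonNBounded p :=
    isVonNBounded_of_pos (AbelianSplitGroup.metricForm A H p.2).toContinuousBilinearMap
      (AbelianSplitGroup.metricForm_pos A hH p.2)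

theorem hasMFDerivAt_mul_left {N : ℕ} (A : Matrix (Fin N) (Fin N) ℝ)
    (p q : AbelianSplitGroup A) :
    HasMFDerivAt 𝓘(ℝ, (Fin N → ℝ) × ℝ) 𝓘(ℝ, (Fin N → ℝ) × ℝ) (fun z => p * z) q
      (((NormedSpace.exp (p.2 • A)).mulVecLin.prodMap LinearMap.id).toContinuousLinearMap :
        ((Fin N → ℝ) × ℝ) →L[ℝ] ((Fin N → ℝ) × ℝ)) := by
  let L : ((Fin N → ℝ) × ℝ) →L[ℝ] ((Fin N → ℝ) × ℝ) :=
    ((NormedSpace.exp (p.2 • A)).mulVecLin.prodMap LinearMap.id).toContinuousLinearMap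
  have h : HasFDerivAt (fun z : (Fin N → ℝ) × ℝ => ((p.1, p.2) : (Fin N → ℝ) × ℝ) + L z) L q :=
    L.hasFDerivAt.const_add _
  exact h.hasMFDerivAt

/-- The metric is invariant under all left translations of the group. -/
theorem leftInvariantMetric_mul_left {N : ℕ} (A H : Matrix (Fin N) (Fin N) ℝ) (hH : H.PosDef)
    (p q : AbelianSplitGroup A) (v w : TangentSpace 𝓘(ℝ, (Fin N → ℝ) × ℝ) q) :
    (leftInvariantMetric A H hH).inner (p * q)
        (mfderiv 𝓘(ℝ, (Fin N → ℝ) × ℝ) 𝓘(ℝ, (Fin N → ℝ) × ℝ) (fun z => p * z) q v)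
        (mfderiv 𝓘(ℝ, (Fin N → ℝ) × ℝ) 𝓘(ℝ, (Fin N → ℝ) × ℝ) (fun z => p * z) q w) =
      (leftInvariantMetric A H hH).inner q v w := by
  rw [(hasMFDerivAt_mul_left A p q).mfderiv]
  have hexp : ∀ ξ : Fin N → ℝ, NormedSpace.exp ((-(p.2 + q.2)) • A) *ᵥ
      (NormedSpace.exp (p.2 • A) *ᵥ ξ) = NormedSpace.exp ((-q.2) • A) *ᵥ ξ := by
    intro ξ
    rw [Matrix.mulVec_mulVec, ← AbelianSplitGroup.exp_add_smul]
    congr 3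
    ring
  change AbelianSplitGroup.metricForm A H (p.2 + q.2)
    (NormedSpace.exp (p.2 • A) *ᵥ v.1, v.2) (NormedSpace.exp (p.2 • A) *ᵥ w.1, w.2) =
      AbelianSplitGroup.metricForm A H q.2 v w
  rw [AbelianSplitGroup.metricForm_apply, hexp, hexp]
  rfl

section Entropy

variable {N : ℕ} {A : Matrix (Fin N) (Fin N) ℝ}

/-- The distance of the Riemannian metric `g`: the infimum of the `g`-lengths of `C¹` paths. -/
noncomputable def metricEDist
    (g : RiemannianMetric (fun p : AbelianSplitGroup A => TangentSpace 𝓘(ℝ, (Fin N → ℝ) × ℝ) p))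
    (p q : AbelianSplitGroup A) : ℝ≥0∞ :=
  letI : RiemannianBundle
      (fun p : AbelianSplitGroup A => TangentSpace 𝓘(ℝ, (Fin N → ℝ) × ℝ) p) := ⟨g⟩
  Manifold.riemannianEDist 𝓘(ℝ, (Fin N → ℝ) × ℝ) p q

/-- The open geodesic ball `B(p, r)` of the Riemannian metric `g`. -/
def geodesicBall
    (g : RiemannianMetric (fun p : AbelianSplitGroup A => TangentSpace 𝓘(ℝ, (Fin N → ℝ) × ℝ) p))
    (p : AbelianSplitGroup A) (r : ℝ) : Set (AbelianSplitGroup A) :=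
  {q | metricEDist g p q < ENNReal.ofReal r}

/-- The coordinate frame `∂_{x₁}, …, ∂_{x_N}, ∂_t` on `ℝᴺ × ℝ`. -/
noncomputable def coordFrame (N : ℕ) : Module.Basis (Fin N ⊕ Unit) ℝ ((Fin N → ℝ) × ℝ) :=
  (Pi.basisFun ℝ (Fin N)).prod (Module.Basis.singleton Unit ℝ)

/-- The Riemannian volume of `g`, `√(det (g_ij)) dx₁ ⋯ dx_N dt`. -/
noncomputable def riemannianVolume
    (g : RiemannianMetric (fun p : AbelianSplitGroup A => TangentSpace 𝓘(ℝ, (Fin N → ℝ) × ℝ) p)) :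
    Measure (AbelianSplitGroup A) :=
  Measure.withDensity (volume : Measure ((Fin N → ℝ) × ℝ)) fun p : AbelianSplitGroup A =>
    ENNReal.ofReal √(Matrix.det (Matrix.of fun i j : Fin N ⊕ Unit =>
      g.inner p (coordFrame N i) (coordFrame N j)))

/-- `g` has volume entropy `δ`: geodesic balls have finite volume and, for every center `p`,
`log Vol(B(p, r)) / r → δ` as `r → ∞`. -/
def HasVolumeEntropy
    (g : RiemannianMetric (fun p : AbelianSplitGroup A => TangentSpace 𝓘(ℝ, (Fin N → ℝ) × ℝ) p))
    (δ : ℝ) : Prop :=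
  ∀ p : AbelianSplitGroup A,
    (∀ r : ℝ, riemannianVolume g (geodesicBall g p r) ≠ ⊤) ∧
    Tendsto (fun r : ℝ => Real.log (riemannianVolume g (geodesicBall g p r)).toReal / r)
      atTop (𝓝 δ)

end Entropy

/-- `A` and `B` are similar over `ℂ`. -/
def ComplexSimilar {N : ℕ} (A B : Matrix (Fin N) (Fin N) ℂ) : Prop :=
  ∃ P : Matrix (Fin N) (Fin N) ℂ, IsUnit P ∧ A * P = P * B

/-- A matrix in Jordan form: block diagonal with upper Jordan blocks. Equivalently, off the
diagonal the only nonzero entries are ones on the superdiagonal, and an entry one in position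
`(i, i + 1)` occurs only where the `i`-th and `(i + 1)`-st diagonal entries agree. -/
def IsJordanMatrix {N : ℕ} (J : Matrix (Fin N) (Fin N) ℂ) : Prop :=
  ∀ i j : Fin N, i ≠ j → J i j ≠ 0 → (j : ℕ) = i + 1 ∧ J i j = 1 ∧ J i i = J j j

/-- The real matrix `A` is diagonalizable over `ℂ`. -/
def DiagonalizableOverComplex {N : ℕ} (A : Matrix (Fin N) (Fin N) ℝ) : Prop :=
  ∃ d : Fin N → ℂ, ComplexSimilar (A.map Complex.ofReal) (Matrix.diagonal d)

/-- `J` is a complex Jordan form of the real matrix `A`. -/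
def IsComplexJordanForm {N : ℕ} (J : Matrix (Fin N) (Fin N) ℂ)
    (A : Matrix (Fin N) (Fin N) ℝ) : Prop :=
  IsJordanMatrix J ∧ ComplexSimilar (A.map Complex.ofReal) J

/-!
The volume entropy is `tr A`, the sum of the eigenvalues of `A`, which is `tr J` by similarity. At
height `t` the Riemannian volume density is `√(det H) |det (exp (-t A))| = √(det H) exp (-t tr A)`,
so volume concentrates at low heights, and the claim amounts to bounds `c exp (r tr A)` and
`C r ^ (N + 1) exp (r tr A)` for the volume of a ball of radius `r`.

Lower bound (`exists_le_riemannianVolume_geodesicBall`): move a bounded distance horizontally from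
`p`, then descend vertically by nearly `r`. The points reached fill a box of fixed size, with
density about `exp (r tr A)`.

Upper bound (`exists_riemannianVolume_geodesicBall_le`): a curve of length less than `r` from height
`t₀` to height `t` stays below `h = (r + t₀ + t) / 2`. Diagonalizability and positivity of the real
parts bound `exp (-s A)` uniformly for `s ≥ 0` (`exists_norm_exp_neg_mulVec_le`), so transporting
the horizontal velocities up to height `h` bounds `exp (-h A) (x - x₀)` linearly in `r`
(`exists_norm_le_of_metricEDist_lt`). The slice of the ball at height `t` therefore has Lebesgue
measure `O(r ^ N) exp (h tr A)`; multiplied by the density this is `O(r ^ N) exp ((h - t) tr A)`,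
and `h - t ≤ r` because `t ≥ t₀ - r`, while `tr A ≥ 0`.

Both bounds are proved directly around an arbitrary center.
-/

/-! ### Exponentials of a matrix diagonalizable over `ℂ` -/

theorem ComplexSimilar.trace_eq {N : ℕ} {A B : Matrix (Fin N) (Fin N) ℂ}
    (h : ComplexSimilar A B) : A.trace = B.trace := by
  obtain ⟨P, hP, hAB⟩ := h
  have hdet : IsUnit P.det := (Matrix.isUnit_iff_isUnit_det P).1 hP
  have hB : B = P⁻¹ * (A * P) := by
    rw [hAB, ← Matrix.mul_assoc, Matrix.nonsing_inv_mul P hdet, Matrix.one_mul]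
  rw [hB, Matrix.trace_mul_comm, Matrix.mul_assoc, Matrix.mul_nonsing_inv P hdet, Matrix.mul_one]

theorem trace_map_ofReal {N : ℕ} (A : Matrix (Fin N) (Fin N) ℝ) :
    (A.map Complex.ofReal).trace = (A.trace : ℂ) := by
  simp [Matrix.trace]

theorem exp_map_ofReal {N : ℕ} (M : Matrix (Fin N) (Fin N) ℝ) :
    (NormedSpace.exp M).map Complex.ofReal = NormedSpace.exp (M.map Complex.ofReal) := by
  -- Matrices carry no global norm; any norm inducing the product topology serves here.
  let : NormedRing (Matrix (Fin N) (Fin N) ℝ) := Matrix.linftyOpNormedRing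
  let : NormedAlgebra ℝ (Matrix (Fin N) (Fin N) ℝ) := Matrix.linftyOpNormedAlgebra
  let : NormedRing (Matrix (Fin N) (Fin N) ℂ) := Matrix.linftyOpNormedRing
  let : NormedAlgebra ℝ (Matrix (Fin N) (Fin N) ℂ) := Matrix.linftyOpNormedAlgebra
  let : NormedAlgebra ℚ (Matrix (Fin N) (Fin N) ℝ) := NormedAlgebra.restrictScalars ℚ ℝ _
  have hc : Continuous (Complex.ofRealHom.mapMatrix : Matrix (Fin N) (Fin N) ℝ →+* _) :=
    continuous_id.matrix_map Complex.continuous_ofReal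
  exact NormedSpace.map_exp (Complex.ofRealHom.mapMatrix : Matrix (Fin N) (Fin N) ℝ →+* _) hc M

theorem exp_smul_map_ofReal_of_diagonal {N : ℕ} {A : Matrix (Fin N) (Fin N) ℝ} {d : Fin N → ℂ}
    {P : Matrix (Fin N) (Fin N) ℂ} (hP : IsUnit P)
    (h : A.map Complex.ofReal * P = P * Matrix.diagonal d) (t : ℝ) :
    (NormedSpace.exp (t • A)).map Complex.ofReal =
      P * Matrix.diagonal (fun i => Complex.exp (t * d i)) * P⁻¹ := by
  have hdet : IsUnit P.det := (Matrix.isUnit_iff_isUnit_det P).1 hP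
  have hA : (t • A).map Complex.ofReal = P * Matrix.diagonal (fun i => (t : ℂ) * d i) * P⁻¹ := by
    have h1 : A.map Complex.ofReal = P * Matrix.diagonal d * P⁻¹ := by
      rw [← h, Matrix.mul_assoc, Matrix.mul_nonsing_inv P hdet, Matrix.mul_one]
    have h2 : (t • A).map Complex.ofReal = (t : ℂ) • A.map Complex.ofReal := by
      ext i j; simp
    have h3 : Matrix.diagonal (fun i => (t : ℂ) * d i) = (t : ℂ) • Matrix.diagonal d := by
      ext i j; by_cases hij : i = j <;> simp [Matrix.diagonal, hij]
    rw [h2, h1, h3, Matrix.mul_smul, Matrix.smul_mul]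
  rw [exp_map_ofReal, hA, Matrix.exp_conj _ _ hP, Matrix.exp_diagonal]
  congr 3
  ext i
  rw [Pi.coe_exp, Complex.exp_eq_exp_ℂ]

/-- Jacobi's formula `det (exp (t A)) = exp (t tr A)`, read off from the eigenvalues. -/
theorem DiagonalizableOverComplex.det_exp_smul {N : ℕ} {A : Matrix (Fin N) (Fin N) ℝ}
    (hA : DiagonalizableOverComplex A) (t : ℝ) :
    (NormedSpace.exp (t • A)).det = Real.exp (t * A.trace) := by
  obtain ⟨d, hd⟩ := hA
  have htr := hd.trace_eq
  rw [trace_map_ofReal, Matrix.trace_diagonal] at htr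
  obtain ⟨P, hP, h⟩ := hd
  have hdet : IsUnit P.det := (Matrix.isUnit_iff_isUnit_det P).1 hP
  have h1 : (((NormedSpace.exp (t • A)).det : ℝ) : ℂ) =
      ((NormedSpace.exp (t • A)).map Complex.ofReal).det :=
    Complex.ofRealHom.map_det _
  rw [exp_smul_map_ofReal_of_diagonal hP h, Matrix.det_mul_right_comm,
    Matrix.mul_nonsing_inv P hdet, Matrix.one_mul, Matrix.det_diagonal, ← Complex.exp_sum,
    ← Finset.mul_sum, ← htr] at h1
  exact_mod_cast h1

/-- The diagonal entries of a diagonal matrix similar to `A` are eigenvalues of `A`. -/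
theorem re_pos_of_diagonal {N : ℕ} {A : Matrix (Fin N) (Fin N) ℝ}
    (hpos : ∀ z : ℂ, Module.End.HasEigenvalue (Matrix.toLin' (A.map Complex.ofReal)) z → 0 < z.re)
    {d : Fin N → ℂ} (hd : ComplexSimilar (A.map Complex.ofReal) (Matrix.diagonal d)) (i : Fin N) :
    0 < (d i).re := by
  obtain ⟨P, hP, h⟩ := hd
  apply hpos
  refine Module.End.hasEigenvalue_of_hasEigenvector (x := P *ᵥ Pi.single i 1) ⟨?_, ?_⟩
  · rw [Module.End.mem_eigenspace_iff, Matrix.toLin'_apply, Matrix.mulVec_mulVec, h,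
      ← Matrix.mulVec_mulVec, Matrix.diagonal_mulVec_single, mul_one, ← Matrix.mulVec_smul]
    congr 1
    rw [← Pi.single_smul, smul_eq_mul, mul_one]
  · intro h0
    have := Matrix.mulVec_injective_of_isUnit hP (h0.trans (Matrix.mulVec_zero P).symm)
    simpa using congrFun this i

theorem trace_nonneg_of_eigenvalues {N : ℕ} {A : Matrix (Fin N) (Fin N) ℝ}
    (hA : DiagonalizableOverComplex A)
    (hpos : ∀ z : ℂ, Module.End.HasEigenvalue (Matrix.toLin' (A.map Complex.ofReal)) z →
      0 < z.re) : 0 ≤ A.trace := by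
  obtain ⟨d, hd⟩ := hA
  have htr := hd.trace_eq
  rw [trace_map_ofReal, Matrix.trace_diagonal] at htr
  have : A.trace = ∑ i, (d i).re := by simpa using congrArg Complex.re htr
  rw [this]
  exact Finset.sum_nonneg fun i _ => (re_pos_of_diagonal hpos hd i).le

/-- The semigroup `exp (-s A)`, `s ≥ 0`, is bounded: conjugating to a diagonal matrix, its entries
are combinations of the numbers `exp (-s dᵢ)`, of modulus at most `1`. -/
theorem exists_norm_exp_neg_mulVec_le {N : ℕ} {A : Matrix (Fin N) (Fin N) ℝ}
    (hA : DiagonalizableOverComplex A)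
    (hpos : ∀ z : ℂ, Module.End.HasEigenvalue (Matrix.toLin' (A.map Complex.ofReal)) z →
      0 < z.re) :
    ∃ K : ℝ, 0 < K ∧ ∀ s : ℝ, 0 ≤ s → ∀ v : Fin N → ℝ,
      ‖NormedSpace.exp ((-s) • A) *ᵥ v‖ ≤ K * ‖v‖ := by
  obtain ⟨d, hd⟩ := hA
  have hre := re_pos_of_diagonal hpos hd
  obtain ⟨P, hP, h⟩ := hd
  set C : ℝ := ∑ i, ∑ j, ∑ k, ‖P i k‖ * ‖P⁻¹ k j‖ with hC
  have hC0 : 0 ≤ C := by positivity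
  refine ⟨C + 1, by positivity, fun s hs v => ?_⟩
  refine (pi_norm_le_iff_of_nonneg (by positivity)).2 fun i => ?_
  have hentry : ∀ j, ‖NormedSpace.exp ((-s) • A) i j‖ ≤ ∑ k, ‖P i k‖ * ‖P⁻¹ k j‖ := by
    intro j
    have h1 := congrFun (congrFun (exp_smul_map_ofReal_of_diagonal hP h (-s)) i) j
    rw [Matrix.map_apply, Matrix.mul_apply] at h1
    rw [← Complex.norm_real, h1]
    refine (norm_sum_le _ _).trans (Finset.sum_le_sum fun k _ => ?_)
    rw [Matrix.mul_diagonal, norm_mul, norm_mul]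
    have : ‖Complex.exp (((-s : ℝ) : ℂ) * d k)‖ ≤ 1 := by
      rw [Complex.norm_exp, Complex.re_ofReal_mul, Real.exp_le_one_iff]
      nlinarith [hre k]
    calc ‖P i k‖ * ‖Complex.exp (((-s : ℝ) : ℂ) * d k)‖ * ‖P⁻¹ k j‖
        ≤ ‖P i k‖ * 1 * ‖P⁻¹ k j‖ := by gcongr
      _ = _ := by rw [mul_one]
  calc ‖(NormedSpace.exp ((-s) • A) *ᵥ v) i‖
      ≤ ∑ j, ‖NormedSpace.exp ((-s) • A) i j * v j‖ :=
        norm_sum_le Finset.univ fun j => NormedSpace.exp ((-s) • A) i j * v j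
    _ ≤ ∑ j, (∑ k, ‖P i k‖ * ‖P⁻¹ k j‖) * ‖v‖ := by
        refine Finset.sum_le_sum fun j _ => ?_
        rw [norm_mul]
        exact mul_le_mul (hentry j) (norm_le_pi_norm v j) (norm_nonneg _) (by positivity)
    _ = (∑ j, ∑ k, ‖P i k‖ * ‖P⁻¹ k j‖) * ‖v‖ := by rw [Finset.sum_mul]
    _ ≤ (C + 1) * ‖v‖ := by
        gcongr
        refine le_add_of_le_of_nonneg ?_ zero_le_one
        exact Finset.single_le_sum (f := fun i => ∑ j, ∑ k, ‖P i k‖ * ‖P⁻¹ k j‖)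
          (fun i _ => by positivity) (Finset.mem_univ i)

/-! ### Curves and the Riemannian distance -/

/-- The length of a tangent vector at a point of height `t`. -/
noncomputable def tangentNorm {N : ℕ} (A H : Matrix (Fin N) (Fin N) ℝ) (t : ℝ)
    (v : (Fin N → ℝ) × ℝ) : ℝ :=
  √(AbelianSplitGroup.metricForm A H t v v)

/-- The norm which the metric puts on the fibers of the tangent bundle is `tangentNorm`. -/
theorem enorm_tangentSpace_eq {N : ℕ} (A H : Matrix (Fin N) (Fin N) ℝ) (hH : H.PosDef)
    (p : AbelianSplitGroup A) (v : TangentSpace 𝓘(ℝ, (Fin N → ℝ) × ℝ) p) :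
    letI : RiemannianBundle
      (fun p : AbelianSplitGroup A => TangentSpace 𝓘(ℝ, (Fin N → ℝ) × ℝ) p) :=
        ⟨leftInvariantMetric A H hH⟩
    ‖v‖ₑ = ENNReal.ofReal (tangentNorm A H p.2 v) := by
  let : RiemannianBundle
      (fun p : AbelianSplitGroup A => TangentSpace 𝓘(ℝ, (Fin N → ℝ) × ℝ) p) :=
        ⟨leftInvariantMetric A H hH⟩
  change ‖v‖ₑ = _
  rw [← ofReal_norm]
  rfl

/-- Curves in `G(A)` are curves in the vector space `ℝᴺ × ℝ`, the manifold derivative being the usual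
one. -/
theorem exists_curve_of_metricEDist_lt {N : ℕ} {A H : Matrix (Fin N) (Fin N) ℝ} {hH : H.PosDef}
    {p q : AbelianSplitGroup A} {r : ℝ≥0∞} (h : metricEDist (leftInvariantMetric A H hH) p q < r) :
    ∃ γ : ℝ → (Fin N → ℝ) × ℝ, γ 0 = p ∧ γ 1 = q ∧ ContDiff ℝ 1 γ ∧
      ∫⁻ u in Icc (0 : ℝ) 1, ENNReal.ofReal (tangentNorm A H (γ u).2 (deriv γ u)) < r := by
  let : RiemannianBundle
      (fun p : AbelianSplitGroup A => TangentSpace 𝓘(ℝ, (Fin N → ℝ) × ℝ) p) :=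
        ⟨leftInvariantMetric A H hH⟩
  obtain ⟨γ, h0, h1, hγ, hlen, -, -⟩ :=
    Manifold.exists_lt_locally_constant_of_riemannianEDist_lt
      (I := 𝓘(ℝ, (Fin N → ℝ) × ℝ)) (M := AbelianSplitGroup A) (x := p) (y := q) h
      (zero_lt_one (α := ℝ))
  refine ⟨γ, h0, h1, contMDiff_iff_contDiff.1 hγ, ?_⟩
  rw [Manifold.pathELength_eq_lintegral_mfderiv_Icc] at hlen
  refine lt_of_eq_of_lt (lintegral_congr fun u => ?_) hlen
  rw [enorm_tangentSpace_eq]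
  congr 2
  let η : ℝ → (Fin N → ℝ) × ℝ := γ
  have hη : mfderiv 𝓘(ℝ, ℝ) 𝓘(ℝ, (Fin N → ℝ) × ℝ) η u = fderiv ℝ η u := mfderiv_eq_fderiv
  exact (congrArg (fun L : ℝ →L[ℝ] (Fin N → ℝ) × ℝ => L 1) hη).symm

theorem metricEDist_le_lintegral {N : ℕ} {A H : Matrix (Fin N) (Fin N) ℝ} {hH : H.PosDef}
    {p q : AbelianSplitGroup A} {γ : ℝ → (Fin N → ℝ) × ℝ} (h0 : γ 0 = p) (h1 : γ 1 = q)
    (hγ : ContDiff ℝ 1 γ) :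
    metricEDist (leftInvariantMetric A H hH) p q ≤
      ∫⁻ u in Icc (0 : ℝ) 1, ENNReal.ofReal (tangentNorm A H (γ u).2 (deriv γ u)) := by
  let : RiemannianBundle
      (fun p : AbelianSplitGroup A => TangentSpace 𝓘(ℝ, (Fin N → ℝ) × ℝ) p) :=
        ⟨leftInvariantMetric A H hH⟩
  let η : ℝ → AbelianSplitGroup A := γ
  have hη : ContMDiffOn 𝓘(ℝ, ℝ) 𝓘(ℝ, (Fin N → ℝ) × ℝ) 1 η (Icc 0 1) := contMDiffOn_iff_contDiffOn.2 hγ.contDiffOn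
  have := Manifold.riemannianEDist_le_pathELength
    (I := 𝓘(ℝ, (Fin N → ℝ) × ℝ)) (M := AbelianSplitGroup A) hη h0 h1 zero_le_one
  refine this.trans_eq ?_
  rw [Manifold.pathELength_eq_lintegral_mfderiv_Icc]
  refine lintegral_congr fun u => ?_
  rw [enorm_tangentSpace_eq]
  congr 2
  have := mfderiv_eq_fderiv (𝕜 := ℝ) (f := (γ : ℝ → (Fin N → ℝ) × ℝ)) (x := u)
  exact congrArg (fun L => L 1) this

theorem metricEDist_triangle {N : ℕ} {A H : Matrix (Fin N) (Fin N) ℝ} {hH : H.PosDef}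
    (p q s : AbelianSplitGroup A) :
    metricEDist (leftInvariantMetric A H hH) p s ≤
      metricEDist (leftInvariantMetric A H hH) p q +
        metricEDist (leftInvariantMetric A H hH) q s := by
  let : RiemannianBundle
      (fun p : AbelianSplitGroup A => TangentSpace 𝓘(ℝ, (Fin N → ℝ) × ℝ) p) :=
        ⟨leftInvariantMetric A H hH⟩
  exact Manifold.riemannianEDist_triangle

/-! ### Bounds for the Riemannian distance -/

theorem abs_snd_le_tangentNorm {N : ℕ} {A H : Matrix (Fin N) (Fin N) ℝ} (hH : H.PosDef) (t : ℝ)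
    (v : (Fin N → ℝ) × ℝ) : |v.2| ≤ tangentNorm A H t v := by
  apply Real.abs_le_sqrt
  have h := hH.posSemidef.dotProduct_mulVec_nonneg (NormedSpace.exp ((-t) • A) *ᵥ v.1)
  rw [star_trivial] at h
  rw [AbelianSplitGroup.metricForm_apply]
  nlinarith

theorem exists_norm_exp_mulVec_le_tangentNorm {N : ℕ} (A : Matrix (Fin N) (Fin N) ℝ)
    {H : Matrix (Fin N) (Fin N) ℝ} (hH : H.PosDef) :
    ∃ C : ℝ, 0 < C ∧ ∀ (t : ℝ) (v : (Fin N → ℝ) × ℝ),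
      ‖NormedSpace.exp ((-t) • A) *ᵥ v.1‖ ≤ C * tangentNorm A H t v := by
  have hb := isVonNBounded_of_pos (AbelianSplitGroup.metricForm A H 0).toContinuousBilinearMap
      (AbelianSplitGroup.metricForm_pos A hH 0)
  rw [NormedSpace.isVonNBounded_iff] at hb
  obtain ⟨C, hC, hbC⟩ := hb.exists_pos_norm_le
  refine ⟨C, hC, fun t v => ?_⟩
  set w : (Fin N → ℝ) × ℝ := (NormedSpace.exp ((-t) • A) *ᵥ v.1, v.2) with hw
  have hvw : tangentNorm A H t v = √(AbelianSplitGroup.metricForm A H 0 w w) := by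
    rw [tangentNorm, AbelianSplitGroup.metricForm_apply, AbelianSplitGroup.metricForm_apply]
    simp [hw]
  have h0 : 0 ≤ tangentNorm A H t v := Real.sqrt_nonneg _
  -- Scale `w` into the unit ball by any `s` exceeding its length.
  have key : ∀ s, tangentNorm A H t v < s → ‖w‖ ≤ C * s := by
    intro s hs
    have hs0 : 0 < s := h0.trans_lt hs
    have hmem : AbelianSplitGroup.metricForm A H 0 (s⁻¹ • w) (s⁻¹ • w) < 1 := by
      rw [hvw, Real.sqrt_lt' hs0] at hs
      simp only [map_smul, LinearMap.smul_apply, smul_eq_mul]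
      field_simp
      linarith
    have := hbC (s⁻¹ • w) hmem
    rw [norm_smul, Real.norm_of_nonneg (by positivity), inv_mul_le_iff₀ hs0] at this
    linarith
  have hle : ‖w‖ ≤ C * tangentNorm A H t v := by
    refine le_of_forall_pos_le_add fun ε hε => ?_
    have := key (tangentNorm A H t v + ε / C) (lt_add_of_pos_right _ (by positivity))
    rwa [mul_add, mul_div_cancel₀ _ hC.ne'] at this
  exact (norm_fst_le w).trans hle

theorem ofReal_norm_map_sub_le_lintegral {E F : Type*} [NormedAddCommGroup E] [NormedSpace ℝ E]
    [NormedAddCommGroup F] [NormedSpace ℝ F] {γ : ℝ → E} (hγ : ContDiff ℝ 1 γ) (L : E →L[ℝ] F)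
    {a b : ℝ} (hab : a ≤ b) :
    ENNReal.ofReal ‖L (γ b) - L (γ a)‖ ≤ ∫⁻ u in Icc a b, ENNReal.ofReal ‖L (deriv γ u)‖ := by
  have h := enorm_sub_le_lintegral_deriv_of_contDiffOn_Icc
    (L.contDiff.comp hγ).contDiffOn hab
  rw [ofReal_norm]
  refine h.trans_eq (lintegral_congr fun u => ?_)
  rw [ofReal_norm]
  congr 1
  exact (L.hasFDerivAt.comp_hasDerivAt u
    ((hγ.differentiable one_ne_zero) u).hasDerivAt).deriv

/-- A curve of length less than `r` from height `p.2` to height `q.2` which reaches the height `s`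
climbs at least `s - p.2` and descends at least `s - q.2`, so it stays below `(r + p.2 + q.2) / 2`.
The horizontal velocities at heights below this level only shrink when they are transported up to
it, up to the bound of the semigroup `exp (-s A)`. -/
theorem exists_norm_le_of_metricEDist_lt {N : ℕ} {A : Matrix (Fin N) (Fin N) ℝ}
    (hA : DiagonalizableOverComplex A)
    (hpos : ∀ z : ℂ, Module.End.HasEigenvalue (Matrix.toLin' (A.map Complex.ofReal)) z → 0 < z.re)
    {H : Matrix (Fin N) (Fin N) ℝ} (hH : H.PosDef) :
    ∃ R : ℝ, 0 < R ∧ ∀ (p q : AbelianSplitGroup A) (r : ℝ), 0 < r →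
      metricEDist (leftInvariantMetric A H hH) p q < ENNReal.ofReal r →
      |q.2 - p.2| ≤ r ∧
        ‖NormedSpace.exp ((-((r + p.2 + q.2) / 2)) • A) *ᵥ (q.1 - p.1)‖ ≤ R * r := by
  obtain ⟨K, hK, hexp⟩ := exists_norm_exp_neg_mulVec_le hA hpos
  obtain ⟨C, hC, hnorm⟩ := exists_norm_exp_mulVec_le_tangentNorm A hH
  refine ⟨K * C, by positivity, fun p q r hr hpq => ?_⟩
  obtain ⟨γ, h0, h1, hγ, hlen⟩ := exists_curve_of_metricEDist_lt hpq
  have hsnd : ∀ a b, a ≤ b → ENNReal.ofReal |(γ b).2 - (γ a).2| ≤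
      ∫⁻ u in Icc a b, ENNReal.ofReal (tangentNorm A H (γ u).2 (deriv γ u)) := by
    intro a b hab
    refine (ofReal_norm_map_sub_le_lintegral hγ
      (ContinuousLinearMap.snd ℝ (Fin N → ℝ) ℝ) hab).trans (lintegral_mono fun u => ?_)
    exact ENNReal.ofReal_le_ofReal (abs_snd_le_tangentNorm hH _ _)
  have hp2 : (γ 0).2 = p.2 := congrArg Prod.snd h0
  have hq2 : (γ 1).2 = q.2 := congrArg Prod.snd h1
  have hp1 : (γ 0).1 = p.1 := congrArg Prod.fst h0
  have hq1 : (γ 1).1 = q.1 := congrArg Prod.fst h1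
  set l : ℝ → ℝ≥0∞ := fun u => ENNReal.ofReal (tangentNorm A H (γ u).2 (deriv γ u)) with hl
  have hheight : ∀ u ∈ Icc (0 : ℝ) 1, (γ u).2 ≤ (r + p.2 + q.2) / 2 := by
    intro u hu
    have hadd : (∫⁻ z in Icc 0 u, l z) + ∫⁻ z in Icc u 1, l z = ∫⁻ z in Icc 0 1, l z := by
      rw [← Icc_union_Ioc_eq_Icc hu.1 hu.2, lintegral_union measurableSet_Ioc,
        restrict_Ioc_eq_restrict_Icc]
      exact disjoint_left.2 fun z hz hz' => (hz.2.trans_lt hz'.1).false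
    have h2 : ENNReal.ofReal (|(γ u).2 - (γ 0).2| + |(γ 1).2 - (γ u).2|) < ENNReal.ofReal r := by
      rw [ENNReal.ofReal_add (abs_nonneg _) (abs_nonneg _)]
      exact ((add_le_add (hsnd 0 u hu.1) (hsnd u 1 hu.2)).trans_eq hadd).trans_lt hlen
    have h3 := (ENNReal.ofReal_lt_ofReal_iff hr).1 h2
    rw [hp2, hq2] at h3
    have h4 := le_abs_self ((γ u).2 - p.2)
    have h5 := neg_abs_le (q.2 - (γ u).2)
    linarith
  constructor
  · have := ((hsnd 0 1 zero_le_one).trans_lt hlen).le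
    rwa [hp2, hq2, ENNReal.ofReal_le_ofReal_iff hr.le] at this
  · set h : ℝ := (r + p.2 + q.2) / 2 with hh
    let L : ((Fin N → ℝ) × ℝ) →L[ℝ] (Fin N → ℝ) :=
      (NormedSpace.exp ((-h) • A)).mulVecLin.toContinuousLinearMap ∘L
        ContinuousLinearMap.fst ℝ (Fin N → ℝ) ℝ
    have hL : ∀ v, L v = NormedSpace.exp ((-h) • A) *ᵥ v.1 := fun v => rfl
    have hLγ := ofReal_norm_map_sub_le_lintegral hγ L zero_le_one
    rw [hL, hL, ← Matrix.mulVec_sub, hp1, hq1] at hLγ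
    have hbound : ∀ u ∈ Icc (0 : ℝ) 1,
        ENNReal.ofReal ‖L (deriv γ u)‖ ≤ ENNReal.ofReal (K * C) * l u := by
      intro u hu
      rw [hl, ← ENNReal.ofReal_mul (by positivity)]
      apply ENNReal.ofReal_le_ofReal
      have hsplit : NormedSpace.exp ((-h) • A) = NormedSpace.exp ((-(h - (γ u).2)) • A) *
          NormedSpace.exp ((-(γ u).2) • A) := by
        rw [← AbelianSplitGroup.exp_add_smul]
        congr 2
        ring
      rw [hL, hsplit, ← Matrix.mulVec_mulVec, mul_assoc]
      refine (hexp _ (sub_nonneg.2 (hheight u hu)) _).trans ?_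
      gcongr
      exact hnorm _ _
    have hfin : ENNReal.ofReal ‖NormedSpace.exp ((-h) • A) *ᵥ (q.1 - p.1)‖ ≤
        ENNReal.ofReal (K * C * r) := by
      calc ENNReal.ofReal ‖NormedSpace.exp ((-h) • A) *ᵥ (q.1 - p.1)‖
          ≤ ∫⁻ u in Icc (0 : ℝ) 1, ENNReal.ofReal (K * C) * l u :=
            hLγ.trans (setLIntegral_mono' measurableSet_Icc hbound)
        _ = ENNReal.ofReal (K * C) * ∫⁻ u in Icc (0 : ℝ) 1, l u :=
            lintegral_const_mul' _ _ ENNReal.ofReal_ne_top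
        _ ≤ ENNReal.ofReal (K * C) * ENNReal.ofReal r := by gcongr
        _ = ENNReal.ofReal (K * C * r) := (ENNReal.ofReal_mul (by positivity)).symm
    exact (ENNReal.ofReal_le_ofReal_iff (by positivity)).1 hfin

theorem metricEDist_horizontal_le {N : ℕ} {A H : Matrix (Fin N) (Fin N) ℝ} {hH : H.PosDef}
    (x v : Fin N → ℝ) (t : ℝ) :
    metricEDist (leftInvariantMetric A H hH) ((x, t) : (Fin N → ℝ) × ℝ)
      ((x + v, t) : (Fin N → ℝ) × ℝ) ≤ ENNReal.ofReal (tangentNorm A H t (v, 0)) := by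
  have hd : ∀ u : ℝ, HasDerivAt (fun u : ℝ => ((x + u • v, t) : (Fin N → ℝ) × ℝ)) (v, 0) u := by
    intro u
    have := (((hasDerivAt_id u).smul_const v).const_add x).prodMk (hasDerivAt_const u t)
    simpa using this
  refine (metricEDist_le_lintegral (γ := fun u : ℝ => ((x + u • v, t) : (Fin N → ℝ) × ℝ))
    (by simp) (by simp) (by fun_prop)).trans_eq ?_
  simp only [(hd _).deriv]
  simp

theorem metricEDist_vertical_le {N : ℕ} {A H : Matrix (Fin N) (Fin N) ℝ} {hH : H.PosDef}
    (x : Fin N → ℝ) (t s : ℝ) :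
    metricEDist (leftInvariantMetric A H hH) ((x, t) : (Fin N → ℝ) × ℝ)
      ((x, s) : (Fin N → ℝ) × ℝ) ≤ ENNReal.ofReal |s - t| := by
  have hd : ∀ u : ℝ, HasDerivAt (fun u : ℝ => ((x, t + u * (s - t)) : (Fin N → ℝ) × ℝ))
      (0, s - t) u := by
    intro u
    have := (hasDerivAt_const u x).prodMk (((hasDerivAt_id u).mul_const (s - t)).const_add t)
    simpa using this
  refine (metricEDist_le_lintegral (γ := fun u : ℝ => ((x, t + u * (s - t)) : (Fin N → ℝ) × ℝ))
    (by simp) (by simp) (by fun_prop)).trans_eq ?_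
  simp only [(hd _).deriv, tangentNorm, AbelianSplitGroup.metricForm_apply]
  simp [Real.sqrt_mul_self_eq_abs]

/-! ### Growth rates and the volume density -/

/-- A polynomial factor does not affect the exponential growth rate. -/
theorem tendsto_log_div_of_le_of_le {V : ℝ → ℝ} {δ c C : ℝ} {k : ℕ} (hc : 0 < c)
    (hlow : ∀ᶠ r in atTop, c * Real.exp (r * δ) ≤ V r)
    (hup : ∀ᶠ r in atTop, V r ≤ C * r ^ k * Real.exp (r * δ)) :
    Tendsto (fun r => Real.log (V r) / r) atTop (𝓝 δ) := by
  have hlog : Tendsto (fun r : ℝ => Real.log r / r) atTop (𝓝 0) := by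
    simpa using Real.isLittleO_log_id_atTop.tendsto_div_nhds_zero
  have h1 : Tendsto (fun r : ℝ => Real.log c / r + δ) atTop (𝓝 δ) := by
    simpa using (tendsto_const_nhds.div_atTop tendsto_id).add (tendsto_const_nhds (x := δ))
  have h2 : Tendsto (fun r : ℝ => Real.log C / r + k * (Real.log r / r) + δ) atTop (𝓝 δ) := by
    simpa using ((tendsto_const_nhds.div_atTop tendsto_id).add (hlog.const_mul (k : ℝ))).add
      (tendsto_const_nhds (x := δ))
  refine tendsto_of_tendsto_of_tendsto_of_le_of_le' h1 h2 ?_ ?_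
  · filter_upwards [hlow, eventually_gt_atTop 0] with r hr hr0
    have h := Real.log_le_log (by positivity) hr
    rw [Real.log_mul hc.ne' (Real.exp_ne_zero _), Real.log_exp] at h
    rw [le_div_iff₀ hr0, add_mul, div_mul_cancel₀ _ hr0.ne']
    linarith
  · filter_upwards [hlow, hup, eventually_gt_atTop 0] with r hr hr' hr0
    have hV : 0 < V r := lt_of_lt_of_le (by positivity) hr
    have hC : 0 < C := by
      have h3 : 0 < C * (r ^ k * Real.exp (r * δ)) := by linarith
      exact pos_of_mul_pos_left h3 (by positivity)
    have h := Real.log_le_log hV hr'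
    rw [Real.log_mul (by positivity) (Real.exp_ne_zero _), Real.log_exp,
      Real.log_mul hC.ne' (by positivity), Real.log_pow] at h
    rw [div_le_iff₀ hr0, add_mul, add_mul, div_mul_cancel₀ _ hr0.ne', mul_assoc,
      div_mul_cancel₀ _ hr0.ne']
    linarith

theorem det_metricForm_coordFrame {N : ℕ} (A H : Matrix (Fin N) (Fin N) ℝ) (t : ℝ) :
    Matrix.det (Matrix.of fun i j : Fin N ⊕ Unit =>
      AbelianSplitGroup.metricForm A H t (coordFrame N i) (coordFrame N j)) =
      (NormedSpace.exp ((-t) • A)).det ^ 2 * H.det := by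
  set E := NormedSpace.exp ((-t) • A) with hE
  have : (Matrix.of fun i j : Fin N ⊕ Unit =>
      AbelianSplitGroup.metricForm A H t (coordFrame N i) (coordFrame N j)) =
      Matrix.fromBlocks (Eᵀ * (H * E)) 0 0 1 := by
    ext i j
    rw [Matrix.of_apply, AbelianSplitGroup.metricForm_apply, ← hE]
    rcases i with i | i <;> rcases j with j | j
    · simp [coordFrame, Matrix.mul_apply, dotProduct, Matrix.mulVec, Pi.single_apply]
    · simp [coordFrame]
    · simp [coordFrame]
    · simp [coordFrame]
  rw [this, Matrix.det_fromBlocks_zero₂₁, Matrix.det_mul, Matrix.det_mul, Matrix.det_transpose,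
    Matrix.det_one]
  ring

/-- The Riemannian volume density at height `t` is `√(det H) exp (-t tr A)`; integrate it over
horizontal slices. -/
theorem riemannianVolume_apply {N : ℕ} {A : Matrix (Fin N) (Fin N) ℝ}
    (hA : DiagonalizableOverComplex A) {H : Matrix (Fin N) (Fin N) ℝ} (hH : H.PosDef)
    {S : Set ((Fin N → ℝ) × ℝ)} (hS : MeasurableSet S) :
    riemannianVolume (leftInvariantMetric A H hH) S =
      ∫⁻ t : ℝ, ENNReal.ofReal (√H.det * Real.exp (-t * A.trace)) *
        volume ((fun x : Fin N → ℝ => (x, t)) ⁻¹' S) := by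
  have hdens : ∀ p : (Fin N → ℝ) × ℝ, √(Matrix.det (Matrix.of fun i j : Fin N ⊕ Unit =>
      (leftInvariantMetric A H hH).inner p (coordFrame N i) (coordFrame N j))) =
      √H.det * Real.exp (-p.2 * A.trace) := by
    intro p
    have h := det_metricForm_coordFrame A H p.2
    rw [hA.det_exp_smul] at h
    refine (congrArg Real.sqrt h).trans ?_
    rw [mul_comm, Real.sqrt_mul hH.det_pos.le, Real.sqrt_sq (Real.exp_pos _).le]
  have hvol : riemannianVolume (leftInvariantMetric A H hH) S =
      ∫⁻ p in S, ENNReal.ofReal (√H.det * Real.exp (-p.2 * A.trace)) := by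
    refine (withDensity_apply _ hS).trans (lintegral_congr fun p => ?_)
    rw [← hdens p]
  have hmeas : Measurable fun p : (Fin N → ℝ) × ℝ =>
      ENNReal.ofReal (√H.det * Real.exp (-p.2 * A.trace)) := by fun_prop
  rw [hvol, ← lintegral_indicator hS, Measure.volume_eq_prod,
    lintegral_prod_symm _ (hmeas.indicator hS).aemeasurable]
  refine lintegral_congr fun t => ?_
  rw [← lintegral_indicator_const (hS.preimage (by fun_prop))]
  rfl

/-! ### Volume of geodesic balls -/

/-- Balls of radius `r` have volume at most a polynomial in `r` times `exp (r tr A)`: at height `t`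
the ball lies in a translate of the image of a sup-norm ball under `exp (h A)`, where
`h = (r + p.2 + t) / 2`, and `h - t ≤ r` on the heights that occur. -/
theorem exists_riemannianVolume_geodesicBall_le {N : ℕ} {A : Matrix (Fin N) (Fin N) ℝ}
    (hA : DiagonalizableOverComplex A)
    (hpos : ∀ z : ℂ, Module.End.HasEigenvalue (Matrix.toLin' (A.map Complex.ofReal)) z → 0 < z.re)
    {H : Matrix (Fin N) (Fin N) ℝ} (hH : H.PosDef) :
    ∃ C : ℝ, 0 < C ∧ ∀ (p : AbelianSplitGroup A) (r : ℝ), 0 < r →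
      riemannianVolume (leftInvariantMetric A H hH)
          (geodesicBall (leftInvariantMetric A H hH) p r) ≤
        ENNReal.ofReal (C * r ^ (N + 1) * Real.exp (r * A.trace)) := by
  obtain ⟨R, hR, hball⟩ := exists_norm_le_of_metricEDist_lt hA hpos hH
  have htr := trace_nonneg_of_eigenvalues hA hpos
  have hdetH : 0 < √H.det := Real.sqrt_pos.2 hH.det_pos
  refine ⟨√H.det * (2 * R) ^ N * 2, by positivity, fun p r hr => ?_⟩
  let E : ℝ → (Fin N → ℝ) → (Fin N → ℝ) := fun t x =>
    NormedSpace.exp ((-((r + p.2 + t) / 2)) • A) *ᵥ (x - p.1)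
  let S : Set ((Fin N → ℝ) × ℝ) := {z | |z.2 - p.2| ≤ r ∧ ‖E z.2 z.1‖ ≤ R * r}
  have hexp : Continuous fun t : ℝ => NormedSpace.exp ((-((r + p.2 + t) / 2)) • A) := by
    have hlin : Continuous fun t : ℝ => (-((r + p.2 + t) / 2)) • A := by fun_prop
    let : NormedRing (Matrix (Fin N) (Fin N) ℝ) := Matrix.linftyOpNormedRing
    let : NormedAlgebra ℝ (Matrix (Fin N) (Fin N) ℝ) := Matrix.linftyOpNormedAlgebra
    let : NormedAlgebra ℚ (Matrix (Fin N) (Fin N) ℝ) := NormedAlgebra.restrictScalars ℚ ℝ _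
    exact NormedSpace.exp_continuous.comp hlin
  have hS : MeasurableSet S := by
    refine IsClosed.measurableSet (IsClosed.inter ?_ ?_)
    · exact isClosed_le (continuous_snd.sub continuous_const).abs continuous_const
    · refine isClosed_le (Continuous.norm ?_) continuous_const
      exact (hexp.comp continuous_snd).matrix_mulVec (continuous_fst.sub continuous_const)
  have hsub : geodesicBall (leftInvariantMetric A H hH) p r ⊆ S := fun q hq => hball p q r hr hq
  have hslice : ∀ t : ℝ, volume {x : Fin N → ℝ | ‖E t x‖ ≤ R * r} =
      ENNReal.ofReal (Real.exp ((r + p.2 + t) / 2 * A.trace) * (2 * (R * r)) ^ N) := by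
    intro t
    let f : (Fin N → ℝ) →ₗ[ℝ] (Fin N → ℝ) :=
      Matrix.toLin' (NormedSpace.exp ((-((r + p.2 + t) / 2)) • A))
    have hdet : LinearMap.det f = Real.exp (-((r + p.2 + t) / 2) * A.trace) := by
      rw [LinearMap.det_toLin', hA.det_exp_smul]
    have hset : {x : Fin N → ℝ | ‖E t x‖ ≤ R * r} =
        (fun x => x + -p.1) ⁻¹' (f ⁻¹' Metric.closedBall 0 (R * r)) := by
      ext x
      simp [E, f, Matrix.toLin'_apply, sub_eq_add_neg]
    rw [hset, measure_preimage_add_right, Measure.addHaar_preimage_linearMap _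
      (by rw [hdet]; exact (Real.exp_pos _).ne'), hdet, Real.volume_pi_closedBall _ (by positivity),
      ← ENNReal.ofReal_mul (abs_nonneg _), Fintype.card_fin, ← Real.exp_neg,
      abs_of_pos (Real.exp_pos _)]
    congr 3
    ring
  refine (measure_mono hsub).trans ?_
  rw [riemannianVolume_apply hA hH hS]
  have hpoint : ∀ t : ℝ, ENNReal.ofReal (√H.det * Real.exp (-t * A.trace)) *
        volume ((fun x : Fin N → ℝ => (x, t)) ⁻¹' S) ≤
      (Icc (p.2 - r) (p.2 + r)).indicator
        (fun _ => ENNReal.ofReal (√H.det * (2 * (R * r)) ^ N * Real.exp (r * A.trace))) t := by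
    intro t
    by_cases ht : |t - p.2| ≤ r
    · have ht' := abs_le.1 ht
      rw [indicator_of_mem (by constructor <;> linarith)]
      have hpre : (fun x : Fin N → ℝ => (x, t)) ⁻¹' S = {x | ‖E t x‖ ≤ R * r} := by
        ext x
        simp [S, ht]
      rw [hpre, hslice, ← ENNReal.ofReal_mul (by positivity)]
      apply ENNReal.ofReal_le_ofReal
      calc √H.det * Real.exp (-t * A.trace) *
            (Real.exp ((r + p.2 + t) / 2 * A.trace) * (2 * (R * r)) ^ N)
          = √H.det * (2 * (R * r)) ^ N *
            (Real.exp (-t * A.trace) * Real.exp ((r + p.2 + t) / 2 * A.trace)) := by ring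
        _ = √H.det * (2 * (R * r)) ^ N * Real.exp ((r + p.2 - t) / 2 * A.trace) := by
            rw [← Real.exp_add]
            ring_nf
        _ ≤ _ := by
            gcongr
            linarith
    · have hpre : (fun x : Fin N → ℝ => (x, t)) ⁻¹' S = ∅ := by
        ext x
        simp [S, ht]
      rw [hpre, measure_empty, mul_zero]
      exact zero_le
  refine (lintegral_mono hpoint).trans ?_
  rw [lintegral_indicator_const measurableSet_Icc, Real.volume_Icc,
    ← ENNReal.ofReal_mul (by positivity)]
  apply ENNReal.ofReal_le_ofReal
  apply le_of_eq
  ring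

/-- The ball around `p` of radius `r` contains the points reached by a short horizontal segment
followed by a descent of length about `r`, where the volume density is about `exp (r tr A)`. -/
theorem exists_le_riemannianVolume_geodesicBall {N : ℕ} {A : Matrix (Fin N) (Fin N) ℝ}
    (hA : DiagonalizableOverComplex A)
    (hpos : ∀ z : ℂ, Module.End.HasEigenvalue (Matrix.toLin' (A.map Complex.ofReal)) z → 0 < z.re)
    {H : Matrix (Fin N) (Fin N) ℝ} (hH : H.PosDef) (p : AbelianSplitGroup A) :
    ∃ c : ℝ, 0 < c ∧ ∀ r : ℝ, 1 < r →
      ENNReal.ofReal (c * Real.exp (r * A.trace)) ≤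
        riemannianVolume (leftInvariantMetric A H hH)
          (geodesicBall (leftInvariantMetric A H hH) p r) := by
  have htr := trace_nonneg_of_eigenvalues hA hpos
  have hdetH : 0 < √H.det := Real.sqrt_pos.2 hH.det_pos
  obtain ⟨ε, hε, hεU⟩ : ∃ ε > 0, ∀ v ∈ Metric.ball (0 : Fin N → ℝ) ε,
      tangentNorm A H p.2 (v, 0) < 1 / 2 := by
    have hcont : Continuous fun v : Fin N → ℝ => tangentNorm A H p.2 (v, 0) := by
      unfold tangentNorm
      simp only [AbelianSplitGroup.metricForm_apply]
      fun_prop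
    have h0 : tangentNorm A H p.2 ((0 : Fin N → ℝ), 0) < 1 / 2 := by
      simp [tangentNorm, AbelianSplitGroup.metricForm_apply]
    exact Metric.eventually_nhds_iff_ball.1 (hcont.continuousAt.eventually_lt_const h0)
  refine ⟨√H.det * Real.exp (-(p.2 + 1) * A.trace) * (2 * ε) ^ N * (1 / 2), by positivity,
    fun r hr => ?_⟩
  let S : Set ((Fin N → ℝ) × ℝ) := Metric.ball p.1 ε ×ˢ Ioo (p.2 - r + 1 / 2) (p.2 - r + 1)
  have hS : MeasurableSet S := measurableSet_ball.prod measurableSet_Ioo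
  have hsub : S ⊆ geodesicBall (leftInvariantMetric A H hH) p r := by
    rintro ⟨x, t⟩ ⟨hx, ht⟩
    have hv : tangentNorm A H p.2 (x - p.1, 0) < 1 / 2 :=
      hεU _ (by simpa [dist_eq_norm] using hx)
    have h1 := metricEDist_horizontal_le (A := A) (hH := hH) p.1 (x - p.1) p.2
    have h2 := metricEDist_vertical_le (A := A) (hH := hH) x p.2 t
    rw [add_sub_cancel] at h1
    have habs : |t - p.2| < r - 1 / 2 := by
      rw [abs_lt]
      have h3 := ht.1
      have h4 := ht.2
      simp only at h3 h4
      constructor <;> linarith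
    have h0 : 0 ≤ tangentNorm A H p.2 (x - p.1, 0) := Real.sqrt_nonneg _
    change metricEDist _ _ _ < _
    refine (metricEDist_triangle p ((x, p.2) : (Fin N → ℝ) × ℝ) _).trans_lt ?_
    refine (add_le_add h1 h2).trans_lt ?_
    rw [← ENNReal.ofReal_add h0 (abs_nonneg _), ENNReal.ofReal_lt_ofReal_iff (by linarith)]
    linarith
  refine le_trans ?_ (measure_mono hsub)
  rw [riemannianVolume_apply hA hH hS]
  have hpoint : ∀ t : ℝ, (Ioo (p.2 - r + 1 / 2) (p.2 - r + 1)).indicator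
        (fun _ => ENNReal.ofReal
          (√H.det * Real.exp (-(p.2 - r + 1) * A.trace) * (2 * ε) ^ N)) t ≤
      ENNReal.ofReal (√H.det * Real.exp (-t * A.trace)) *
        volume ((fun x : Fin N → ℝ => (x, t)) ⁻¹' S) := by
    intro t
    by_cases ht : t ∈ Ioo (p.2 - r + 1 / 2) (p.2 - r + 1)
    swap
    · rw [indicator_of_notMem ht]
      exact zero_le
    rw [indicator_of_mem ht]
    have hpre : (fun x : Fin N → ℝ => (x, t)) ⁻¹' S = Metric.ball p.1 ε := by
      rw [mk_preimage_prod_left ht]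
    rw [hpre, Real.volume_pi_ball _ hε, Fintype.card_fin, ← ENNReal.ofReal_mul (by positivity)]
    apply ENNReal.ofReal_le_ofReal
    have := ht.2.le
    gcongr
  refine le_trans ?_ (lintegral_mono hpoint)
  rw [lintegral_indicator_const measurableSet_Ioo, Real.volume_Ioo,
    ← ENNReal.ofReal_mul (by positivity)]
  apply ENNReal.ofReal_le_ofReal
  have hsplit : Real.exp (-(p.2 - r + 1) * A.trace) =
      Real.exp (-(p.2 + 1) * A.trace) * Real.exp (r * A.trace) := by
    rw [← Real.exp_add]
    ring_nf
  rw [hsplit]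
  apply le_of_eq
  ring

theorem hasVolumeEntropy_trace {N : ℕ} {A : Matrix (Fin N) (Fin N) ℝ}
    (hA : DiagonalizableOverComplex A)
    (hpos : ∀ z : ℂ, Module.End.HasEigenvalue (Matrix.toLin' (A.map Complex.ofReal)) z → 0 < z.re)
    {H : Matrix (Fin N) (Fin N) ℝ} (hH : H.PosDef) :
    HasVolumeEntropy (leftInvariantMetric A H hH) A.trace := by
  intro p
  obtain ⟨C, hC, hup⟩ := exists_riemannianVolume_geodesicBall_le hA hpos hH
  obtain ⟨c, hc, hlow⟩ := exists_le_riemannianVolume_geodesicBall hA hpos hH p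
  have hfin : ∀ r : ℝ, riemannianVolume (leftInvariantMetric A H hH)
      (geodesicBall (leftInvariantMetric A H hH) p r) ≠ ⊤ := by
    intro r
    rcases le_or_gt r 0 with hr | hr
    · have : geodesicBall (leftInvariantMetric A H hH) p r = ∅ := by
        ext q
        simp [geodesicBall, ENNReal.ofReal_of_nonpos hr]
      simp [this]
    · exact ((hup p r hr).trans_lt ENNReal.ofReal_lt_top).ne
  refine ⟨hfin, tendsto_log_div_of_le_of_le hc (C := C) (k := N + 1) ?_ ?_⟩
  · filter_upwards [eventually_gt_atTop 1] with r hr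
    exact (ENNReal.ofReal_le_iff_le_toReal (hfin r)).1 (hlow r hr)
  · filter_upwards [eventually_gt_atTop 0] with r hr
    exact ENNReal.toReal_le_of_le_ofReal (by positivity) (hup p r hr)

theorem mainTheorem3 (N : ℕ) (A : Matrix (Fin N) (Fin N) ℝ)
    (hdiag : DiagonalizableOverComplex A)
    (hpos : ∀ z : ℂ, Module.End.HasEigenvalue (Matrix.toLin' (A.map Complex.ofReal)) z → 0 < z.re)
    (J : Matrix (Fin N) (Fin N) ℂ) (hJ : IsComplexJordanForm J A)
    (H : Matrix (Fin N) (Fin N) ℝ) (hH : H.PosDef) :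
    ∃ δ : ℝ, HasVolumeEntropy (leftInvariantMetric A H hH) δ ∧ (δ : ℂ) = J.trace := by
  refine ⟨A.trace, hasVolumeEntropy_trace hdiag hpos hH, ?_⟩
  rw [← trace_map_ofReal, hJ.2.trace_eq]
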